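/- Let $\Xi_0=[-1,1]$ and, for $n\ge 0$, let $\Xi_{n+1}=\Xi_n\cap[a_{n+1}-1,a_{n+1}+1]$, where, given $a_1,\dots,a_n$, the point $a_{n+1}$ is uniformly distributed on the segment $\Xi_n$. Let $Z_n$ be the centre of $\Xi_n$. Then the limit $Z=\lim_{n\to\infty}Z_n$ exists almost surely, and its distribution is the arcsine law on $[-1/2,1/2]$: for $-1/2\le x\le 1/2$, $$\mathbb P(Z\le x)=\frac{2}{\pi}\arcsin\sqrt{x+\tfrac12}\,.$$ The following reformulation holds as well. Let $v=(v_0,v_1,\dots)$ have the GEM distribution with parameter $1$, i.e. $v$ has the law of the sequence $\bigl(U_1U_2\cdots U_i(1-U_{i+1})\bigr)_{i\ge 0}$ with $U_1,U_2,\dots$ i.i.d. uniform on $(0,1)$, and let $\xi_1,\xi_2,\dots$ be i.i.d. with $\mathbb P(\xi_i=1)=\mathbb P(\xi_i=-1)=1/2$, independent of $v$. Then $\sum_{i=0}^\infty v_i\xi_{i+1}$ converges almost surely, and its distribution is the arcsine law on $[-1,1]$: for $-1\le x\le 1$, $$\mathbb P\Bigl(\sum_{i=0}^\infty v_i\xi_{i+1}\le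 x\Bigr)=\frac{2}{\pi}\arcsin\sqrt{\tfrac{x+1}{2}}\,.$$ -/

import Mathlib

open MeasureTheory ProbabilityTheory Filter Topology

namespace DiminishingSegment

/-- The segments determined by a sequence of points: `seg a 0 = [-1, 1]` and
`seg a (n + 1) = seg a n ∩ [a n - 1, a n + 1]`. The entry `a n` of the sequence is the point that
is used in the step from the `n`-th to the `(n + 1)`-st segment. -/
def seg (a : ℕ → ℝ) : ℕ → Set ℝ
  | 0 => Set.Icc (-1) 1
  | n + 1 => seg a n ∩ Set.Icc (a n - 1) (a n + 1)

/-- The left endpoint of the `n`-th segment. -/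
noncomputable def left (a : ℕ → ℝ) : ℕ → ℝ
  | 0 => -1
  | n + 1 => max (left a n) (a n - 1)

/-- The right endpoint of the `n`-th segment. -/
noncomputable def right (a : ℕ → ℝ) : ℕ → ℝ
  | 0 => 1
  | n + 1 => min (right a n) (a n + 1)

theorem seg_eq_Icc (a : ℕ → ℝ) (n : ℕ) : seg a n = Set.Icc (left a n) (right a n) := by
  induction n with
  | zero => rfl
  | succ n ih => simp only [seg, left, right, ih, Set.Icc_inter_Icc]

/-- The centre `Z n` of the `n`-th segment. -/
noncomputable def centre (a : ℕ → ℝ) (n : ℕ) : ℝ := (left a n + right a n) / 2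

/-- The radius of the `n`-th segment. -/
noncomputable def radius (a : ℕ → ℝ) (n : ℕ) : ℝ := (right a n - left a n) / 2

theorem seg_eq_centre_radius (a : ℕ → ℝ) (n : ℕ) :
    seg a n = Set.Icc (centre a n - radius a n) (centre a n + radius a n) := by
  rw [seg_eq_Icc]
  congr 1 <;> simp only [centre, radius] <;> ring

/-- The random points `a 0, a 1, …` drive a diminishing segment process: for every `n`, given
the previous points `a 0, …, a (n - 1)`, the point `a n` is uniformly distributed on the current
segment (the regular conditional distribution of `a n` given `(a 0, …, a (n - 1))` is almost
surely the normalized Lebesgue measure on that segment). -/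
structure IsSegmentProcess {Ω : Type*} [MeasurableSpace Ω] (P : Measure Ω)
    [IsProbabilityMeasure P] (a : ℕ → Ω → ℝ) : Prop where
  measurable : ∀ n, Measurable (a n)
  uniform : ∀ n, ∀ᵐ ω ∂P,
    condDistrib (a n) (fun ω' (i : Fin n) => a i ω') P (fun i => a i ω) =
      volume[|seg (fun k => a k ω) n]

/-- Stick breaking: `u` is sent to the sequence `v i = u 0 * ⋯ * u (i - 1) * (1 - u i)`. -/
noncomputable def stickBreaking (u : ℕ → unitInterval) (i : ℕ) : ℝ :=
  (∏ j ∈ Finset.range i, (u j : ℝ)) * (1 - (u i : ℝ))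

/-- The GEM (Griffiths–Engen–McCloskey) distribution with parameter `1`: the law of the
stick-breaking sequence of independent uniform variables on `[0, 1]`. -/
noncomputable def gemOne : Measure (ℕ → ℝ) :=
  (Measure.infinitePi fun _ : ℕ => (volume : Measure unitInterval)).map stickBreaking

theorem measurable_stickBreaking : Measurable stickBreaking := by
  unfold stickBreaking
  fun_prop

/-- `ξ 0, ξ 1, …` are independent random signs, `1` or `-1` with probability `1 / 2` each. -/
structure IsRandomSigns {Ω : Type*} [MeasurableSpace Ω] (P : Measure Ω)
    (ξ : ℕ → Ω → ℝ) : Prop where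
  measurable : ∀ i, Measurable (ξ i)
  indep : iIndepFun ξ P
  prob_one : ∀ i, P {ω | ξ i ω = 1} = 1 / 2
  prob_neg_one : ∀ i, P {ω | ξ i ω = -1} = 1 / 2

end DiminishingSegment

/-! Both statements concern a random segment $[L,M]$ shrinking to a point. When it changes, one
endpoint, chosen by a fair coin, is replaced by a uniform point of $[L,M]$. For the diminishing
segments $[l,r]$, whose lengths decrease to $1$, take $[L,M]=[l+1/2,r-1/2]$, the range left for the
limit centre. A uniform $y\in[l,r]$ moves $M$ to $y+1/2$ if $y<r-1$, moves $L$ to $y-1/2$ if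
$y>l+1$, and otherwise changes nothing. For the signed sum, take the segment centred at the partial
sum with the remaining stick length as radius; the next sign selects the endpoint that stays.

Let $h_g(L,M)$ be the mean of $g$ under the arcsine law on $[L,M]$. This function is harmonic for
the dynamics (`integral_arcsineMean_add`), so $h_g$ of the random segment has constant expectation.
As the segment shrinks to a point $Z$, $h_g$ tends to $g(Z)$, and dominated convergence gives
$\mathbb E\,g(Z)=h_g$ of the initial segment (`cdf_limit_of_integral_arcsineMean_eq`). It remains to
prove the shrinking (`ae_tendsto_excess`, `ae_tendsto_gem_remainder`) and the two Markov properties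
(`integral_succ`, `integral_stickLaw_step`). -/

namespace DiminishingSegment

/-! ### Arcsine means and their harmonicity. -/

/-- The mean of `g` under the arcsine law on the segment with endpoints `L` and `M`. -/
noncomputable def arcsineMean (g : ℝ → ℝ) (L M : ℝ) : ℝ :=
  2 / Real.pi * ∫ θ in (0 : ℝ)..Real.pi / 2, g (L * Real.cos θ ^ 2 + M * Real.sin θ ^ 2)

theorem continuous_arcsineMean {g : ℝ → ℝ} (hg : Continuous g) :
    Continuous fun p : ℝ × ℝ => arcsineMean g p.1 p.2 := by
  unfold arcsineMean
  refine continuous_const.mul ?_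
  apply intervalIntegral.continuous_parametric_intervalIntegral_of_continuous'
  fun_prop

theorem arcsineMean_self (g : ℝ → ℝ) (L : ℝ) : arcsineMean g L L = g L := by
  have h : ∀ θ, L * Real.cos θ ^ 2 + L * Real.sin θ ^ 2 = L := fun θ => by
    rw [← mul_add, Real.cos_sq_add_sin_sq, mul_one]
  simp only [arcsineMean, h, intervalIntegral.integral_const, smul_eq_mul]
  field_simp [Real.pi_pos.ne']
  ring

theorem abs_arcsineMean_le {g : ℝ → ℝ} {C : ℝ} (hg : ∀ y, |g y| ≤ C) (L M : ℝ) :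
    |arcsineMean g L M| ≤ C := by
  have h := intervalIntegral.norm_integral_le_of_norm_le_const (a := 0) (b := Real.pi / 2)
    (f := fun θ => g (L * Real.cos θ ^ 2 + M * Real.sin θ ^ 2)) (C := C) (fun θ _ => hg _)
  rw [Real.norm_eq_abs, sub_zero, abs_of_pos (by positivity : 0 < Real.pi / 2)] at h
  rw [arcsineMean, abs_mul, abs_of_pos (by positivity : 0 < 2 / Real.pi)]
  calc _ ≤ 2 / Real.pi * (C * (Real.pi / 2)) := by gcongr
    _ = C := by field_simp

/-- The proof exhibits a primitive in `θ` of the difference of the two integrands. -/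
theorem integral_segment_averages {g : ℝ → ℝ} (hg : Continuous g) (L M : ℝ) :
    ∫ θ in (0 : ℝ)..Real.pi / 2, (∫ l in L..M,
      (g (l * Real.cos θ ^ 2 + M * Real.sin θ ^ 2) + g (L * Real.cos θ ^ 2 + l * Real.sin θ ^ 2))) =
    2 * (M - L) *
      ∫ θ in (0 : ℝ)..Real.pi / 2, g (L * Real.cos θ ^ 2 + M * Real.sin θ ^ 2) := by
  set G : ℝ → ℝ := fun y => ∫ t in (0 : ℝ)..y, g t with hG
  have hG' : ∀ y, HasDerivAt G (g y) y := fun y =>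
    intervalIntegral.integral_hasDerivAt_right (hg.intervalIntegrable _ _)
      (hg.stronglyMeasurableAtFilter _ _) hg.continuousAt
  set Y : ℝ → ℝ := fun θ => L * Real.cos θ ^ 2 + M * Real.sin θ ^ 2 with hY
  have hY' : ∀ θ, HasDerivAt Y (2 * (M - L) * (Real.sin θ * Real.cos θ)) θ := fun θ => by
    have h1 := ((Real.hasDerivAt_cos θ).pow 2).const_mul L
    have h2 := ((Real.hasDerivAt_sin θ).pow 2).const_mul M
    refine (h1.add h2).congr_deriv ?_
    simp
    ring
  have hYc : Continuous Y := by fun_prop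
  set A : ℝ → ℝ := fun θ => ∫ l in L..M, g (l * Real.cos θ ^ 2 + M * Real.sin θ ^ 2) with hAdef
  set C : ℝ → ℝ := fun θ => ∫ l in L..M, g (L * Real.cos θ ^ 2 + l * Real.sin θ ^ 2) with hCdef
  -- Substitution $y=l\cos^2\theta+M\sin^2\theta$; the product form needs no division by
  -- $\cos\theta$.
  have hA : ∀ θ, A θ * Real.cos θ ^ 2 = G M - G (Y θ) := fun θ => by
    rw [hAdef, mul_comm]
    simp only [mul_comm _ (Real.cos θ ^ 2)]
    rw [intervalIntegral.mul_integral_comp_mul_add (f := g), mul_comm (Real.cos θ ^ 2) M, ← mul_add,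
      Real.cos_sq_add_sin_sq, mul_one, mul_comm (Real.cos θ ^ 2) L, hG,
      intervalIntegral.integral_interval_sub_left (hg.intervalIntegrable _ _)
        (hg.intervalIntegrable _ _)]
  have hC : ∀ θ, C θ * Real.sin θ ^ 2 = G (Y θ) - G L := fun θ => by
    rw [hCdef, mul_comm]
    simp only [mul_comm _ (Real.sin θ ^ 2)]
    rw [intervalIntegral.mul_integral_comp_add_mul (f := g), mul_comm (Real.sin θ ^ 2) M,
      mul_comm (Real.sin θ ^ 2) L, ← mul_add, Real.cos_sq_add_sin_sq, mul_one, hG,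
      intervalIntegral.integral_interval_sub_left (hg.intervalIntegrable _ _)
        (hg.intervalIntegrable _ _)]
  have hAc : Continuous A := by
    apply intervalIntegral.continuous_parametric_intervalIntegral_of_continuous'
    fun_prop
  have hCc : Continuous C := by
    apply intervalIntegral.continuous_parametric_intervalIntegral_of_continuous'
    fun_prop
  -- The primitive. In the interior it equals $(G(M)-G(Y))\tan\theta-(G(Y)-G(L))\cot\theta$, which
  -- is easy to differentiate; the form here is continuous up to both ends.
  set K : ℝ → ℝ := fun θ => Real.sin θ * Real.cos θ * (A θ - C θ) with hK
  have hsum : ∀ θ, (∫ l in L..M, (g (l * Real.cos θ ^ 2 + M * Real.sin θ ^ 2) +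
      g (L * Real.cos θ ^ 2 + l * Real.sin θ ^ 2))) = A θ + C θ := fun θ =>
    intervalIntegral.integral_add (Continuous.intervalIntegrable (by fun_prop) _ _)
      (Continuous.intervalIntegrable (by fun_prop) _ _)
  simp only [hsum]
  clear_value A C G
  have key : ∫ θ in (0 : ℝ)..Real.pi / 2, (A θ + C θ - 2 * (M - L) * g (Y θ)) =
      K (Real.pi / 2) - K 0 := by
    refine intervalIntegral.integral_eq_sub_of_hasDerivAt_of_le (by positivity)
      (Continuous.continuousOn (by fun_prop)) (fun θ hθ => ?_)
      (Continuous.intervalIntegrable (by fun_prop) _ _)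
    have hc : ∀ t ∈ Set.Ioo 0 (Real.pi / 2), Real.cos t ≠ 0 := fun t ht =>
      (Real.cos_pos_of_mem_Ioo ⟨by linarith [ht.1, Real.pi_pos], ht.2⟩).ne'
    have hs : ∀ t ∈ Set.Ioo 0 (Real.pi / 2), Real.sin t ≠ 0 := fun t ht =>
      (Real.sin_pos_of_pos_of_lt_pi ht.1 (by linarith [ht.2, Real.pi_pos])).ne'
    have hev : K =ᶠ[𝓝 θ] fun t => (G M - G (Y t)) * (Real.sin t / Real.cos t) -
        (G (Y t) - G L) * (Real.cos t / Real.sin t) := by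
      filter_upwards [isOpen_Ioo.mem_nhds hθ] with t ht
      have := hc t ht
      have := hs t ht
      rw [← hA, ← hC]
      simp only [hK]
      field_simp
    refine HasDerivAt.congr_of_eventuallyEq ?_ hev
    have hGY := (hG' (Y θ)).comp θ (hY' θ)
    have h1 := (hGY.const_sub (G M)).mul
      ((Real.hasDerivAt_sin θ).div (Real.hasDerivAt_cos θ) (hc θ hθ))
    have h2 := (hGY.sub_const (G L)).mul
      ((Real.hasDerivAt_cos θ).div (Real.hasDerivAt_sin θ) (hs θ hθ))
    refine (h1.sub h2).congr_deriv ?_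
    have h3 := hc θ hθ
    have h4 := hs θ hθ
    have h5 := Real.sin_sq_add_cos_sq θ
    have e1 : Real.cos θ * Real.cos θ - Real.sin θ * -Real.sin θ = 1 := by linarith
    have e2 : -Real.sin θ * Real.sin θ - Real.cos θ * Real.cos θ = -1 := by linarith
    simp only [Function.comp_apply, Pi.div_apply]
    rw [e1, e2, ← hA, ← hC]
    field_simp
    linear_combination (-2 * (M - L) * g (Y θ)) * h5
  rw [intervalIntegral.integral_sub (Continuous.intervalIntegrable (by fun_prop) _ _)
    (Continuous.intervalIntegrable (by fun_prop) _ _), intervalIntegral.integral_const_mul] at key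
  -- Both boundary values vanish because of the factor $\sin\theta\cos\theta$.
  simp only [hK, Real.sin_zero, Real.cos_pi_div_two] at key
  linarith

/-- The arcsine mean is harmonic for the dynamics that replaces one endpoint of the segment,
chosen by a fair coin, by a uniform point of the segment. -/
theorem integral_arcsineMean_add {g : ℝ → ℝ} (hg : Continuous g) (L M : ℝ) :
    ∫ l in L..M, (arcsineMean g l M + arcsineMean g L l) = 2 * (M - L) * arcsineMean g L M := by
  have h : ∀ l, arcsineMean g l M + arcsineMean g L l = 2 / Real.pi *
      ∫ θ in (0 : ℝ)..Real.pi / 2, (g (l * Real.cos θ ^ 2 + M * Real.sin θ ^ 2) +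
        g (L * Real.cos θ ^ 2 + l * Real.sin θ ^ 2)) := fun l => by
    rw [intervalIntegral.integral_add (Continuous.intervalIntegrable (by fun_prop) _ _)
      (Continuous.intervalIntegrable (by fun_prop) _ _), arcsineMean, arcsineMean, mul_add]
  simp only [h, intervalIntegral.integral_const_mul]
  rw [intervalIntegral_intervalIntegral_swap, integral_segment_averages hg, arcsineMean]
  · ring
  · refine (ContinuousOn.integrableOn_compact (isCompact_uIcc.prod isCompact_uIcc)
      (Continuous.continuousOn ?_)).mono_set
      (Set.prod_mono Set.uIoc_subset_uIcc Set.uIoc_subset_uIcc)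
    unfold Function.uncurry
    fun_prop

/-! ### The arcsine law and the identification of the limit. -/

/-- The arcsine law on the segment with endpoints `L` and `M`. -/
noncomputable def arcsineLaw (L M : ℝ) : Measure ℝ :=
  (ENNReal.ofReal (2 / Real.pi) • volume.restrict (Set.Ioc 0 (Real.pi / 2))).map
    fun θ => L * Real.cos θ ^ 2 + M * Real.sin θ ^ 2

instance (L M : ℝ) : IsFiniteMeasure (arcsineLaw L M) := by
  have : IsFiniteMeasure
      (ENNReal.ofReal (2 / Real.pi) • volume.restrict (Set.Ioc (0 : ℝ) (Real.pi / 2))) :=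
    Measure.smul_finite _ ENNReal.ofReal_ne_top
  unfold arcsineLaw
  infer_instance

theorem integral_arcsineLaw {g : ℝ → ℝ} (hg : Continuous g) (L M : ℝ) :
    ∫ y, g y ∂arcsineLaw L M = arcsineMean g L M := by
  rw [arcsineLaw, integral_map (by fun_prop) hg.aestronglyMeasurable, integral_smul_measure,
    arcsineMean, intervalIntegral.integral_of_le (by positivity),
    ENNReal.toReal_ofReal (by positivity), smul_eq_mul]

/-- Since $L\cos^2\theta+M\sin^2\theta=L+(M-L)\sin^2\theta$, the event is an initial interval of
angles, ending at the arcsine on the right. -/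
theorem arcsineLaw_real_Iic {L M x : ℝ} (hLM : L < M) (hx : x ∈ Set.Icc L M) :
    (arcsineLaw L M).real (Set.Iic x) =
      2 / Real.pi * Real.arcsin (Real.sqrt ((x - L) / (M - L))) := by
  have hML : 0 < M - L := sub_pos.2 hLM
  have hy0 : 0 ≤ (x - L) / (M - L) := div_nonneg (sub_nonneg.2 hx.1) hML.le
  have hy1 : (x - L) / (M - L) ≤ 1 := (div_le_one hML).2 (by linarith [hx.2])
  set α := Real.arcsin (Real.sqrt ((x - L) / (M - L))) with hα
  have hα0 : 0 ≤ α := Real.arcsin_nonneg.2 (Real.sqrt_nonneg _)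
  have hα1 : α ≤ Real.pi / 2 := Real.arcsin_le_pi_div_two _
  have hset : (fun θ => L * Real.cos θ ^ 2 + M * Real.sin θ ^ 2) ⁻¹' Set.Iic x ∩
      Set.Ioc 0 (Real.pi / 2) = Set.Ioc 0 α := by
    ext θ
    have hmem : 0 < θ → θ ≤ Real.pi / 2 →
        (L * Real.cos θ ^ 2 + M * Real.sin θ ^ 2 ≤ x ↔ θ ≤ α) := fun h0 h1 => by
      have hs : 0 ≤ Real.sin θ := Real.sin_nonneg_of_nonneg_of_le_pi h0.le (by linarith)
      rw [hα, Real.le_arcsin_iff_sin_le ⟨by linarith [Real.pi_pos], h1⟩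
        ⟨by linarith [Real.sqrt_nonneg ((x - L) / (M - L))], Real.sqrt_le_one.2 hy1⟩,
        Real.le_sqrt hs, le_div_iff₀ hML, Real.cos_sq']
      · constructor <;> intro h <;> linarith
      · exact hy0
    simp only [Set.mem_inter_iff, Set.mem_preimage, Set.mem_Iic, Set.mem_Ioc]
    constructor
    · rintro ⟨h, h0, h1⟩
      exact ⟨h0, (hmem h0 h1).1 h⟩
    · rintro ⟨h0, h1⟩
      exact ⟨(hmem h0 (h1.trans hα1)).2 h1, h0, h1.trans hα1⟩
  rw [measureReal_def, arcsineLaw, Measure.map_apply (by fun_prop) measurableSet_Iic,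
    Measure.smul_apply, Measure.restrict_apply' measurableSet_Ioc, hset, Real.volume_Ioc,
    smul_eq_mul, ENNReal.toReal_mul, ENNReal.toReal_ofReal (by positivity),
    ENNReal.toReal_ofReal (by linarith), sub_zero]

/-- If a random segment shrinks to a point and its arcsine means have constant expectation, then
the limit point has the arcsine law on the initial segment. -/
theorem cdf_limit_of_integral_arcsineMean_eq {Ω : Type*} [MeasurableSpace Ω] {P : Measure Ω}
    [IsProbabilityMeasure P] {X Y : ℕ → Ω → ℝ} {Z : Ω → ℝ} {L M : ℝ}
    (hX : ∀ n, Measurable (X n)) (hY : ∀ n, Measurable (Y n)) (hZ : AEMeasurable Z P)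
    (hXZ : ∀ᵐ ω ∂P, Tendsto (fun n => X n ω) atTop (𝓝 (Z ω)))
    (hYZ : ∀ᵐ ω ∂P, Tendsto (fun n => Y n ω) atTop (𝓝 (Z ω)))
    (hmean : ∀ g : ℝ → ℝ, Continuous g → (∃ C, ∀ y, |g y| ≤ C) →
      ∀ n, ∫ ω, arcsineMean g (X n ω) (Y n ω) ∂P = arcsineMean g L M)
    (hLM : L < M) {x : ℝ} (hx : x ∈ Set.Icc L M) :
    P.real {ω | Z ω ≤ x} = 2 / Real.pi * Real.arcsin (Real.sqrt ((x - L) / (M - L))) := by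
  have hlaw : P.map Z = arcsineLaw L M := by
    refine ext_of_forall_integral_eq_of_IsFiniteMeasure fun f => ?_
    have hfC : ∀ y, |f y| ≤ ‖f‖ := fun y => f.norm_coe_le_norm y
    rw [integral_map hZ f.continuous.aestronglyMeasurable, integral_arcsineLaw f.continuous]
    have hcont := continuous_arcsineMean f.continuous
    have h := tendsto_integral_of_dominated_convergence (μ := P)
      (F := fun n ω => arcsineMean f (X n ω) (Y n ω)) (f := fun ω => f (Z ω)) (fun _ => ‖f‖)
      (fun n => (hcont.measurable.comp ((hX n).prodMk (hY n))).aestronglyMeasurable)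
      (integrable_const _) (fun n => .of_forall fun ω => abs_arcsineMean_le hfC _ _) (by
        filter_upwards [hXZ, hYZ] with ω h1 h2
        rw [← arcsineMean_self f (Z ω)]
        exact (hcont.tendsto (Z ω, Z ω)).comp (h1.prodMk_nhds h2))
    simp only [hmean f f.continuous ⟨_, hfC⟩] at h
    exact tendsto_nhds_unique h tendsto_const_nhds
  rw [← arcsineLaw_real_Iic hLM hx, ← hlaw, map_measureReal_apply_of_aemeasurable hZ
    measurableSet_Iic]
  rfl

/-! ### The endpoints as functions of the driving points, and one step of the segment. -/

theorem monotone_left (a : ℕ → ℝ) : Monotone (left a) :=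
  monotone_nat_of_le_succ fun _ => le_max_left _ _

theorem antitone_right (a : ℕ → ℝ) : Antitone (right a) :=
  antitone_nat_of_succ_le fun _ => min_le_left _ _

theorem neg_one_le_left (a : ℕ → ℝ) (n : ℕ) : -1 ≤ left a n := monotone_left a n.zero_le

theorem right_le_one (a : ℕ → ℝ) (n : ℕ) : right a n ≤ 1 := antitone_right a n.zero_le

theorem left_congr {a b : ℕ → ℝ} {n : ℕ} (h : ∀ k < n, a k = b k) : left a n = left b n := by
  induction n with
  | zero => rfl
  | succ n ih => rw [left, left, ih fun k hk => h k (hk.trans n.lt_succ_self), h n n.lt_succ_self]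

theorem right_congr {a b : ℕ → ℝ} {n : ℕ} (h : ∀ k < n, a k = b k) : right a n = right b n := by
  induction n with
  | zero => rfl
  | succ n ih =>
    rw [right, right, ih fun k hk => h k (hk.trans n.lt_succ_self), h n n.lt_succ_self]

theorem measurable_left (n : ℕ) : Measurable fun a : ℕ → ℝ => left a n := by
  induction n with
  | zero => exact measurable_const
  | succ n ih => exact ih.max ((measurable_pi_apply n).sub_const 1)

theorem measurable_right (n : ℕ) : Measurable fun a : ℕ → ℝ => right a n := by
  induction n with
  | zero => exact measurable_const
  | succ n ih => exact ih.min ((measurable_pi_apply n).add_const 1)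

/-- Extension of a finite sequence by zero. -/
def extendByZero {n : ℕ} (x : Fin n → ℝ) (k : ℕ) : ℝ := if h : k < n then x ⟨k, h⟩ else 0

theorem measurable_extendByZero {n : ℕ} : Measurable (extendByZero (n := n)) := by
  refine measurable_pi_lambda _ fun k => ?_
  by_cases h : k < n
  · simpa only [extendByZero, h, dif_pos] using measurable_pi_apply _
  · simpa only [extendByZero, h, dif_neg, not_false_eq_true] using measurable_const

/-- Makes the $n$-th segment a function of the finite prefix on which `IsSegmentProcess` conditions.
-/
theorem left_extendByZero (a : ℕ → ℝ) (n : ℕ) :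
    left (extendByZero fun i : Fin n => a i) n = left a n :=
  left_congr fun k hk => by simp [extendByZero, hk]

theorem right_extendByZero (a : ℕ → ℝ) (n : ℕ) :
    right (extendByZero fun i : Fin n => a i) n = right a n :=
  right_congr fun k hk => by simp [extendByZero, hk]

theorem integral_cond_Icc {l r : ℝ} (h : l < r) (f : ℝ → ℝ) :
    ∫ y, f y ∂volume[|Set.Icc l r] = (r - l)⁻¹ * ∫ y in l..r, f y := by
  rw [ProbabilityTheory.cond, integral_smul_measure, integral_Icc_eq_integral_Ioc,
    intervalIntegral.integral_of_le h.le, Real.volume_Icc, ENNReal.toReal_inv,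
    ENNReal.toReal_ofReal (sub_nonneg.2 h.le), smul_eq_mul]

/-- The mean of a function of the next segment, given the current one. The segment `[l, r]` is
parametrized by the endpoints `l + 1 / 2` and `r - 1 / 2` of the range of its eventual centre. -/
theorem integral_next_segment {ψ : ℝ → ℝ → ℝ} (hψ : Continuous fun p : ℝ × ℝ => ψ p.1 p.2)
    {l r : ℝ} (h1 : 1 ≤ r - l) (h2 : r - l ≤ 2) :
    ∫ y, ψ (max l (y - 1) + 1 / 2) (min r (y + 1) - 1 / 2) ∂volume[|Set.Icc l r] =
      (r - l)⁻¹ * ((∫ t in (l + 1 / 2)..(r - 1 / 2), (ψ t (r - 1 / 2) + ψ (l + 1 / 2) t)) +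
        (2 - (r - l)) * ψ (l + 1 / 2) (r - 1 / 2)) := by
  have hψ' : ∀ {f g : ℝ → ℝ}, Continuous f → Continuous g → Continuous fun y => ψ (f y) (g y) :=
    fun hf hg => hψ.comp (hf.prodMk hg)
  rw [integral_cond_Icc (by linarith)]
  congr 1
  set F : ℝ → ℝ := fun y => ψ (max l (y - 1) + 1 / 2) (min r (y + 1) - 1 / 2) with hF
  have hFc : Continuous F := hψ' (by fun_prop) (by fun_prop)
  -- As $1\le r-l\le 2$, the points $l\le r-1\le l+1\le r$ cut the range of $y$ in three: only the
  -- right endpoint moves, nothing moves, only the left endpoint moves.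
  have i1 : ∫ y in l..(r - 1), F y = ∫ t in (l + 1 / 2)..(r - 1 / 2), ψ (l + 1 / 2) t := by
    have : ∫ y in l..(r - 1), F y = ∫ y in l..(r - 1), (fun t => ψ (l + 1 / 2) t) (y + 1 / 2) := by
      refine intervalIntegral.integral_congr fun y hy => ?_
      rw [Set.uIcc_of_le (by linarith)] at hy
      simp only [hF]
      rw [max_eq_left (by linarith [hy.2]), min_eq_right (by linarith [hy.2])]
      congr 1
      ring
    rw [this, intervalIntegral.integral_comp_add_right]
    congr 1
    ring
  have i2 : ∫ y in (r - 1)..(l + 1), F y = (2 - (r - l)) * ψ (l + 1 / 2) (r - 1 / 2) := by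
    have : ∫ y in (r - 1)..(l + 1), F y = ∫ y in (r - 1)..(l + 1), ψ (l + 1 / 2) (r - 1 / 2) := by
      refine intervalIntegral.integral_congr fun y hy => ?_
      rw [Set.uIcc_of_le (by linarith)] at hy
      simp only [hF]
      rw [max_eq_left (by linarith [hy.2]), min_eq_left (by linarith [hy.1])]
    rw [this, intervalIntegral.integral_const, smul_eq_mul]
    ring
  have i3 : ∫ y in (l + 1)..r, F y = ∫ t in (l + 1 / 2)..(r - 1 / 2), ψ t (r - 1 / 2) := by
    have : ∫ y in (l + 1)..r, F y = ∫ y in (l + 1)..r, (fun t => ψ t (r - 1 / 2)) (y - 1 / 2) := by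
      refine intervalIntegral.integral_congr fun y hy => ?_
      rw [Set.uIcc_of_le (by linarith)] at hy
      simp only [hF]
      rw [max_eq_right (by linarith [hy.1]), min_eq_left (by linarith [hy.1])]
      congr 1
      ring
    rw [this, intervalIntegral.integral_comp_sub_right (fun t => ψ t (r - 1 / 2))]
    congr 1
    ring
  rw [intervalIntegral.integral_add ((hψ' (by fun_prop) (by fun_prop)).intervalIntegrable _ _)
    ((hψ' (by fun_prop) (by fun_prop)).intervalIntegrable _ _), ← i1, ← i2, ← i3,
    ← intervalIntegral.integral_add_adjacent_intervals (hFc.intervalIntegrable l (r - 1))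
      (hFc.intervalIntegrable (r - 1) r),
    ← intervalIntegral.integral_add_adjacent_intervals (hFc.intervalIntegrable (r - 1) (l + 1))
      (hFc.intervalIntegrable (l + 1) r)]
  ring

/-! ### The diminishing segment process. -/

namespace IsSegmentProcess

variable {Ω : Type*} [MeasurableSpace Ω] {P : Measure Ω} [IsProbabilityMeasure P]
  {a : ℕ → Ω → ℝ}

theorem measurable_path (h : IsSegmentProcess P a) : Measurable fun ω k => a k ω :=
  measurable_pi_lambda _ h.measurable

theorem measurable_left (h : IsSegmentProcess P a) (n : ℕ) :
    Measurable fun ω => left (fun k => a k ω) n :=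
  (DiminishingSegment.measurable_left n).comp h.measurable_path

theorem measurable_right (h : IsSegmentProcess P a) (n : ℕ) :
    Measurable fun ω => right (fun k => a k ω) n :=
  (DiminishingSegment.measurable_right n).comp h.measurable_path

/-- Disintegrate the joint law of prefix and next point: almost every fibre of the bad set is the
complement of the current segment, null for the uniform law on it. -/
theorem ae_mem_seg (h : IsSegmentProcess P a) (n : ℕ)
    (hn : ∀ᵐ ω ∂P, 1 ≤ right (fun k => a k ω) n - left (fun k => a k ω) n) :
    ∀ᵐ ω ∂P, a n ω ∈ Set.Icc (left (fun k => a k ω) n) (right (fun k => a k ω) n) := by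
  set X : Ω → Fin n → ℝ := fun ω i => a i ω with hX
  have hXm : Measurable X := measurable_pi_lambda _ fun i => h.measurable i
  set S : Set ((Fin n → ℝ) × ℝ) :=
    {p | p.2 ∈ Set.Icc (left (extendByZero p.1) n) (right (extendByZero p.1) n)}ᶜ with hS
  have hSm : MeasurableSet S :=
    ((measurableSet_le
      ((DiminishingSegment.measurable_left n).comp (measurable_extendByZero.comp measurable_fst))
      measurable_snd).inter (measurableSet_le measurable_snd
      ((DiminishingSegment.measurable_right n).comp
        (measurable_extendByZero.comp measurable_fst)))).compl
  have hzero : P.map (fun ω => (X ω, a n ω)) S = 0 := by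
    rw [← compProd_map_condDistrib (h.measurable n).aemeasurable, Measure.compProd_apply hSm,
      lintegral_map (Kernel.measurable_kernel_prodMk_left hSm) hXm]
    refine (lintegral_congr_ae (g := fun _ => 0) ?_).trans lintegral_zero
    filter_upwards [h.uniform n, hn] with ω hω hω1
    have hpre : Prod.mk (X ω) ⁻¹' S = (seg (fun k => a k ω) n)ᶜ := by
      ext y
      simp only [hS, hX, seg_eq_Icc, Set.mem_preimage, Set.mem_compl_iff, Set.mem_ofPred_eq,
        left_extendByZero (fun k => a k ω) n, right_extendByZero (fun k => a k ω) n]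
    have hne : volume (seg (fun k => a k ω) n) ≠ 0 := by
      rw [seg_eq_Icc, Real.volume_Icc]
      simp only [ne_eq, ENNReal.ofReal_eq_zero, not_le]
      linarith
    have hmeas : MeasurableSet (seg (fun k => a k ω) n) := by
      rw [seg_eq_Icc]
      exact measurableSet_Icc
    rw [hω, hpre, cond_apply hmeas, Set.inter_compl_self, measure_empty, mul_zero]
  rw [Measure.map_apply (hXm.prodMk (h.measurable n)) hSm] at hzero
  filter_upwards [measure_eq_zero_iff_ae_notMem.1 hzero] with ω hω
  simpa only [hS, hX, Set.preimage_compl, Set.mem_compl_iff, not_not, Set.mem_preimage,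
    Set.mem_ofPred_eq, left_extendByZero (fun k => a k ω) n,
    right_extendByZero (fun k => a k ω) n] using hω

/-- Cutting at distance $1$ on both sides of a point of a segment of length at least $1$ leaves
length at least $1$. -/
theorem ae_one_le (h : IsSegmentProcess P a) (n : ℕ) :
    ∀ᵐ ω ∂P, 1 ≤ right (fun k => a k ω) n - left (fun k => a k ω) n := by
  induction n with
  | zero => exact .of_forall fun ω => by simp only [left, right]; norm_num
  | succ n ih =>
    filter_upwards [ih, h.ae_mem_seg n ih] with ω h1 h2
    rw [left, right, le_sub_iff_add_le, le_min_iff, ← le_sub_iff_add_le', ← le_sub_iff_add_le']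
    constructor <;> apply max_le <;> linarith [h2.1, h2.2]

/-- The Markov property of the sequence of segments. -/
theorem integral_succ (h : IsSegmentProcess P a) {ψ : ℝ → ℝ → ℝ}
    (hψ : Continuous fun p : ℝ × ℝ => ψ p.1 p.2) (n : ℕ)
    (hint : Integrable (fun ω => ψ (left (fun k => a k ω) (n + 1) + 1 / 2)
      (right (fun k => a k ω) (n + 1) - 1 / 2)) P) :
    ∫ ω, ψ (left (fun k => a k ω) (n + 1) + 1 / 2) (right (fun k => a k ω) (n + 1) - 1 / 2) ∂P =
      ∫ ω, (right (fun k => a k ω) n - left (fun k => a k ω) n)⁻¹ *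
        ((∫ t in (left (fun k => a k ω) n + 1 / 2)..(right (fun k => a k ω) n - 1 / 2),
          (ψ t (right (fun k => a k ω) n - 1 / 2) + ψ (left (fun k => a k ω) n + 1 / 2) t)) +
        (2 - (right (fun k => a k ω) n - left (fun k => a k ω) n)) *
          ψ (left (fun k => a k ω) n + 1 / 2) (right (fun k => a k ω) n - 1 / 2)) ∂P := by
  set X : Ω → Fin n → ℝ := fun ω i => a i ω with hX
  have hXm : Measurable X := measurable_pi_lambda _ fun i => h.measurable i
  set f : (Fin n → ℝ) × ℝ → ℝ := fun p => ψ (max (left (extendByZero p.1) n) (p.2 - 1) + 1 / 2)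
    (min (right (extendByZero p.1) n) (p.2 + 1) - 1 / 2) with hf
  have hfm : Measurable f := hψ.measurable.comp
    (((((DiminishingSegment.measurable_left n).comp
      (measurable_extendByZero.comp measurable_fst)).max (measurable_snd.sub_const 1)).add_const
        (1 / 2)).prodMk
    ((((DiminishingSegment.measurable_right n).comp
      (measurable_extendByZero.comp measurable_fst)).min (measurable_snd.add_const 1)).sub_const
        (1 / 2)))
  have hfX : ∀ ω y, f (X ω, y) = ψ (max (left (fun k => a k ω) n) (y - 1) + 1 / 2)
      (min (right (fun k => a k ω) n) (y + 1) - 1 / 2) := fun ω y => by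
    simp only [hf, hX, left_extendByZero (fun k => a k ω) n,
      right_extendByZero (fun k => a k ω) n]
  -- Condition on the prefix, then integrate the next point against its uniform conditional law.
  have hcond := condExp_prod_ae_eq_integral_condDistrib (μ := P) hXm
    (h.measurable n).aemeasurable hfm.stronglyMeasurable
    (hint.congr (.of_forall fun ω => (hfX ω (a n ω)).symm))
  calc _ = ∫ ω, f (X ω, a n ω) ∂P := integral_congr_ae (.of_forall fun ω => (hfX ω (a n ω)).symm)
    _ = _ := (integral_condExp hXm.comap_le).symm
    _ = _ := integral_congr_ae hcond
    _ = _ := integral_congr_ae (by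
      filter_upwards [h.uniform n, h.ae_one_le n] with ω hω h1
      simp only [hfX]
      rw [hω, seg_eq_Icc, integral_next_segment hψ h1]
      linarith [neg_one_le_left (fun k => a k ω) n, right_le_one (fun k => a k ω) n])

theorem integral_arcsineMean (h : IsSegmentProcess P a) {g : ℝ → ℝ} (hg : Continuous g) {C : ℝ}
    (hC : ∀ y, |g y| ≤ C) (n : ℕ) :
    ∫ ω, arcsineMean g (left (fun k => a k ω) n + 1 / 2) (right (fun k => a k ω) n - 1 / 2) ∂P =
      arcsineMean g (-1 / 2) (1 / 2) := by
  induction n with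
  | zero =>
    simp only [left, right, integral_const, probReal_univ, one_smul]
    norm_num
  | succ n ih =>
    have hcont := continuous_arcsineMean hg
    rw [h.integral_succ hcont, ← ih]
    · refine integral_congr_ae ?_
      filter_upwards [h.ae_one_le n] with ω h1
      -- Here $M-L=r-l-1$, so the weights add up: $2(r-l-1)+(2-(r-l))=r-l$.
      rw [integral_arcsineMean_add hg, inv_mul_eq_iff_eq_mul₀ (by linarith)]
      ring
    · refine Integrable.of_bound (hcont.measurable.comp (((h.measurable_left _).add_const _).prodMk
        ((h.measurable_right _).sub_const _))).aestronglyMeasurable C (.of_forall fun ω => ?_)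
      exact abs_arcsineMean_le hC _ _

/-- The one-step evolution of the mean excess of the length of the segment over `1`. -/
theorem integral_excess_succ (h : IsSegmentProcess P a) (n : ℕ) :
    ∫ ω, (right (fun k => a k ω) (n + 1) - left (fun k => a k ω) (n + 1) - 1) ∂P =
      ∫ ω, (right (fun k => a k ω) n - left (fun k => a k ω) n - 1) /
        (right (fun k => a k ω) n - left (fun k => a k ω) n) ∂P := by
  have hmeas : ∀ n, Measurable fun ω => right (fun k => a k ω) n - left (fun k => a k ω) n - 1 :=
    fun n => ((h.measurable_right n).sub (h.measurable_left n)).sub_const 1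
  -- The excess $s=r-l-1$ is $M-L$; its conditional mean after a step is
  -- $(s^2+(1-s)s)/(1+s)=s/(1+s)$.
  have hstep := h.integral_succ (ψ := fun L M => M - L) (by fun_prop) n
  have e : ∀ l r : ℝ, r - 1 / 2 - (l + 1 / 2) = r - l - 1 := fun l r => by ring
  simp only [e] at hstep
  rw [hstep]
  · refine integral_congr_ae ?_
    filter_upwards [h.ae_one_le n] with ω h1
    have e2 : ∀ L M t : ℝ, M - t + (t - L) = M - L := fun L M t => by ring
    simp only [e2, intervalIntegral.integral_const, smul_eq_mul]
    have : right (fun k => a k ω) n - left (fun k => a k ω) n ≠ 0 := by linarith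
    field_simp
    ring
  · refine Integrable.of_bound (hmeas _).aestronglyMeasurable 1 ?_
    filter_upwards [h.ae_one_le (n + 1)] with ω h1
    rw [Real.norm_eq_abs, abs_of_nonneg (by linarith)]
    linarith [neg_one_le_left (fun k => a k ω) (n + 1), right_le_one (fun k => a k ω) (n + 1)]

/-- On $[0,1]$, $s/(1+s)\le s-s^2/2$, so $\mathbb E s_n^2\le 2(\mathbb E s_n-\mathbb E s_{n+1})$.
The means decrease and are nonnegative, hence the right side tends to $0$; monotonicity of $s_n$ in
$n$ turns this into almost sure convergence. -/
theorem ae_tendsto_excess (h : IsSegmentProcess P a) :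
    ∀ᵐ ω ∂P, Tendsto
      (fun n => (right (fun k => a k ω) n - left (fun k => a k ω) n - 1)) atTop (𝓝 0) := by
  set s : ℕ → Ω → ℝ := fun n ω => right (fun k => a k ω) n - left (fun k => a k ω) n - 1 with hs
  have hmeas : ∀ n, Measurable (s n) :=
    fun n => ((h.measurable_right n).sub (h.measurable_left n)).sub_const 1
  have h0 : ∀ᵐ ω ∂P, ∀ n, 0 ≤ s n ω := by
    filter_upwards [ae_all_iff.2 h.ae_one_le] with ω hω n
    linarith [hω n]
  have h1 : ∀ n ω, s n ω ≤ 1 := fun n ω => by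
    simp only [hs]
    linarith [neg_one_le_left (fun k => a k ω) n, right_le_one (fun k => a k ω) n]
  have hanti : ∀ ω, Antitone fun n => s n ω := fun ω m n hmn => by
    have := monotone_left (fun k => a k ω) hmn
    have := antitone_right (fun k => a k ω) hmn
    simp only [hs]
    linarith
  have hint : ∀ n, Integrable (s n) P := fun n => by
    refine Integrable.of_bound (hmeas n).aestronglyMeasurable 1 ?_
    filter_upwards [h0] with ω hω
    rw [Real.norm_eq_abs, abs_of_nonneg (hω n)]
    exact h1 n ω
  have hint2 : ∀ n, Integrable (fun ω => s n ω ^ 2) P := fun n => by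
    refine Integrable.of_bound ((hmeas n).pow_const 2).aestronglyMeasurable 1 ?_
    filter_upwards [h0] with ω hω
    rw [Real.norm_eq_abs, abs_of_nonneg (sq_nonneg _)]
    exact pow_le_one₀ (hω n) (h1 n ω)
  have hdec : ∀ n, ∫ ω, s (n + 1) ω ∂P ≤ ∫ ω, s n ω ∂P - 1 / 2 * ∫ ω, s n ω ^ 2 ∂P := fun n => by
    rw [← integral_const_mul, ← integral_sub (hint n) ((hint2 n).const_mul _)]
    simp only [hs]
    rw [h.integral_excess_succ]
    have hle : ∀ᵐ ω ∂P, s n ω / (s n ω + 1) ≤ s n ω - 1 / 2 * s n ω ^ 2 := by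
      filter_upwards [h0] with ω hω
      rw [div_le_iff₀ (by linarith [hω n])]
      nlinarith [mul_nonneg (sq_nonneg (s n ω)) (sub_nonneg.2 (h1 n ω))]
    have e : ∀ n ω, right (fun k => a k ω) n - left (fun k => a k ω) n = s n ω + 1 :=
      fun n ω => by simp only [hs]; ring
    simp only [e, add_sub_cancel_right]
    refine integral_mono_of_nonneg ?_ ((hint n).sub ((hint2 n).const_mul _)) hle
    filter_upwards [h0] with ω hω
    exact div_nonneg (hω n) (by linarith [hω n])
  have hnonneg : ∀ n, 0 ≤ ∫ ω, s n ω ∂P := fun n =>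
    integral_nonneg_of_ae (h0.mono fun ω hω => hω n)
  have hnonneg2 : ∀ n, 0 ≤ ∫ ω, s n ω ^ 2 ∂P := fun n => integral_nonneg fun ω => sq_nonneg _
  have hlim : Tendsto (fun n => ∫ ω, s n ω ∂P) atTop (𝓝 (⨅ n, ∫ ω, s n ω ∂P)) :=
    tendsto_atTop_ciInf (antitone_nat_of_succ_le fun n => by linarith [hdec n, hnonneg2 n])
      ⟨0, by rintro _ ⟨n, rfl⟩; exact hnonneg n⟩
  have hlim2 : Tendsto (fun n => ∫ ω, s n ω ^ 2 ∂P) atTop (𝓝 0) := by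
    have := (hlim.sub (hlim.comp (tendsto_add_atTop_nat 1))).const_mul 2
    rw [sub_self, mul_zero] at this
    exact squeeze_zero hnonneg2 (fun n => by simp only [Function.comp_apply]; linarith [hdec n])
      this
  have hae := tendsto_of_integral_tendsto_of_antitone (F := fun _ => (0 : ℝ)) hint2
    (integrable_const _) (by simpa using hlim2) (by
      filter_upwards [h0] with ω hω m n hmn
      exact pow_le_pow_left₀ (hω n) (hanti ω hmn) 2) (.of_forall fun ω n => sq_nonneg _)
  filter_upwards [hae, h0] with ω hω h0ω
  have := hω.sqrt
  rw [Real.sqrt_zero] at this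
  exact this.congr fun n => Real.sqrt_sq (h0ω n)

theorem exists_limit_arcsine (h : IsSegmentProcess P a) :
    ∃ Z : Ω → ℝ, Measurable Z ∧
      (∀ᵐ ω ∂P, Tendsto (fun n => centre (fun k => a k ω) n) atTop (𝓝 (Z ω))) ∧
      ∀ x ∈ Set.Icc (-1 / 2 : ℝ) (1 / 2),
        P.real {ω | Z ω ≤ x} = 2 / Real.pi * Real.arcsin (Real.sqrt (x + 1 / 2)) := by
  have hconv : ∀ᵐ ω ∂P, ∃ z, Tendsto (fun n => left (fun k => a k ω) n + 1 / 2) atTop (𝓝 z) := by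
    filter_upwards [ae_all_iff.2 h.ae_one_le] with ω hω
    refine ⟨_, (tendsto_atTop_ciSup (monotone_left _) ⟨1, ?_⟩).add_const _⟩
    rintro _ ⟨n, rfl⟩
    linarith [hω n, right_le_one (fun k => a k ω) n]
  obtain ⟨Z, hZm, hZ⟩ := measurable_limit_of_tendsto_metrizable_ae
    (fun n => ((h.measurable_left n).add_const (1 / 2)).aemeasurable) hconv
  -- The two shifted endpoints differ by the excess, and the centre is their midpoint.
  have hZ' : ∀ᵐ ω ∂P, Tendsto (fun n => right (fun k => a k ω) n - 1 / 2) atTop (𝓝 (Z ω)) := by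
    filter_upwards [hZ, h.ae_tendsto_excess] with ω h1 h2
    have := h1.add h2
    rw [add_zero] at this
    exact this.congr fun n => by ring
  refine ⟨Z, hZm, ?_, fun x hx => ?_⟩
  · filter_upwards [hZ, hZ'] with ω h1 h2
    have := (h1.add h2).div_const 2
    rw [add_self_div_two] at this
    exact this.congr fun n => by rw [centre]; ring
  · rw [cdf_limit_of_integral_arcsineMean_eq (fun n => (h.measurable_left n).add_const (1 / 2))
      (fun n => (h.measurable_right n).sub_const (1 / 2)) hZm.aemeasurable hZ hZ'
      (fun g hg ⟨C, hC⟩ n => h.integral_arcsineMean hg hC n) (by norm_num) hx]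
    norm_num

end IsSegmentProcess

/-! ### Independence in products, and the law of the signs. -/

theorem map_prodProdProdComm {α β γ δ : Type*} [MeasurableSpace α] [MeasurableSpace β]
    [MeasurableSpace γ] [MeasurableSpace δ] (μ : Measure α) (ν : Measure β) (ρ : Measure γ)
    (σ : Measure δ) [SFinite μ] [SFinite ν] [SFinite ρ] [SFinite σ] :
    ((μ.prod ν).prod (ρ.prod σ)).map (Equiv.prodProdProdComm α β γ δ) =
      (μ.prod ρ).prod (ν.prod σ) := by
  have hm : Measurable (Equiv.prodProdProdComm α β γ δ) :=
    ((measurable_fst.comp measurable_fst).prodMk (measurable_fst.comp measurable_snd)).prodMk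
      ((measurable_snd.comp measurable_fst).prodMk (measurable_snd.comp measurable_snd))
  refine Measure.ext_of_lintegral _ fun f hf => ?_
  have hf' : Measurable fun p : (α × β) × (γ × δ) => f (Equiv.prodProdProdComm α β γ δ p) :=
    hf.comp hm
  rw [lintegral_map hf hm, lintegral_prod _ hf'.aemeasurable, lintegral_prod _ hf.aemeasurable,
    lintegral_prod _ hf'.lintegral_prod_right'.aemeasurable,
    lintegral_prod _ hf.lintegral_prod_right'.aemeasurable]
  refine lintegral_congr fun x => ?_
  have e1 : ∀ y, ∫⁻ q, f (Equiv.prodProdProdComm α β γ δ ((x, y), q)) ∂ρ.prod σ =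
      ∫⁻ z, ∫⁻ w, f ((x, z), (y, w)) ∂σ ∂ρ := fun y =>
    lintegral_prod _ (hf'.comp measurable_prodMk_left).aemeasurable
  have e2 : ∀ z, ∫⁻ q, f ((x, z), q) ∂ν.prod σ = ∫⁻ y, ∫⁻ w, f ((x, z), (y, w)) ∂σ ∂ν := fun z =>
    lintegral_prod _ (hf.comp measurable_prodMk_left).aemeasurable
  simp only [e1, e2]
  refine lintegral_lintegral_swap (Measurable.aemeasurable ?_)
  exact Measurable.lintegral_prod_right' (f := fun p : (β × γ) × δ =>
    f ((x, p.1.2), (p.1.1, p.2))) (by fun_prop)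

/-- Combines "past independent of present" for the fractions and for the signs into one statement
about pairs. -/
theorem indepFun_prodMap {Ω Ω' α β γ δ : Type*} [MeasurableSpace Ω] [MeasurableSpace Ω']
    [MeasurableSpace α] [MeasurableSpace β] [MeasurableSpace γ] [MeasurableSpace δ]
    {μ : Measure Ω} {ν : Measure Ω'} [IsProbabilityMeasure μ] [IsProbabilityMeasure ν]
    {X : Ω → α} {Y : Ω → β} {X' : Ω' → γ} {Y' : Ω' → δ} (hX : Measurable X) (hY : Measurable Y)
    (hX' : Measurable X') (hY' : Measurable Y') (h : IndepFun X Y μ) (h' : IndepFun X' Y' ν) :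
    IndepFun (fun w : Ω × Ω' => (X w.1, X' w.2)) (fun w => (Y w.1, Y' w.2)) (μ.prod ν) := by
  have hm : Measurable (Equiv.prodProdProdComm α β γ δ) :=
    ((measurable_fst.comp measurable_fst).prodMk (measurable_fst.comp measurable_snd)).prodMk
      ((measurable_snd.comp measurable_fst).prodMk (measurable_snd.comp measurable_snd))
  have e1 : (μ.prod ν).map (fun w => (X w.1, X' w.2)) = (μ.map X).prod (ν.map X') :=
    (Measure.map_prod_map μ ν hX hX').symm
  have e2 : (μ.prod ν).map (fun w => (Y w.1, Y' w.2)) = (μ.map Y).prod (ν.map Y') :=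
    (Measure.map_prod_map μ ν hY hY').symm
  have e3 := Measure.map_prod_map μ ν (hX.prodMk hY) (hX'.prodMk hY')
  rw [(indepFun_iff_map_prod_eq_prod_map_map hX.aemeasurable hY.aemeasurable).1 h,
    (indepFun_iff_map_prod_eq_prod_map_map hX'.aemeasurable hY'.aemeasurable).1 h'] at e3
  rw [indepFun_iff_map_prod_eq_prod_map_map (by fun_prop) (by fun_prop), e1, e2,
    ← map_prodProdProdComm, e3, Measure.map_map hm (by fun_prop)]
  rfl

/-- The law of a random sign. -/
noncomputable def signLaw : Measure ℝ :=
  (1 / 2 : ENNReal) • Measure.dirac 1 + (1 / 2 : ENNReal) • Measure.dirac (-1)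

instance : IsProbabilityMeasure signLaw :=
  ⟨by simp [signLaw, ENNReal.inv_two_add_inv_two]⟩

theorem integral_signLaw (f : ℝ → ℝ) : ∫ e, f e ∂signLaw = (f 1 + f (-1)) / 2 := by
  have hi : ∀ x : ℝ, Integrable f ((1 / 2 : ENNReal) • Measure.dirac x) := fun x =>
    (integrable_dirac (by simp)).smul_measure (by simp)
  rw [signLaw, integral_add_measure (hi _) (hi _)]
  simp only [integral_smul_measure, integral_dirac, smul_eq_mul]
  norm_num
  ring

/-- The two atoms already carry mass $1$, so the law is its restriction to them. -/
theorem IsRandomSigns.map_eq_signLaw {Ω : Type*} [MeasurableSpace Ω] {P : Measure Ω}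
    [IsProbabilityMeasure P] {ξ : ℕ → Ω → ℝ} (h : IsRandomSigns P ξ) (i : ℕ) :
    P.map (ξ i) = signLaw := by
  have := Measure.isProbabilityMeasure_map (μ := P) (h.measurable i).aemeasurable
  have h1 : P.map (ξ i) {1} = 1 / 2 :=
    (Measure.map_apply (h.measurable i) (measurableSet_singleton _)).trans (h.prob_one i)
  have h2 : P.map (ξ i) {-1} = 1 / 2 :=
    (Measure.map_apply (h.measurable i) (measurableSet_singleton _)).trans (h.prob_neg_one i)
  have hdisj : Disjoint ({1} : Set ℝ) {-1} := by
    rw [Set.disjoint_singleton]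
    norm_num
  have hmeas : MeasurableSet ({1} ∪ {-1} : Set ℝ) := by measurability
  have hone : P.map (ξ i) ({1} ∪ {-1}) = 1 := by
    rw [measure_union hdisj (measurableSet_singleton _), h1, h2, ENNReal.add_halves]
  have hae : ∀ᵐ x ∂P.map (ξ i), x ∈ ({1} ∪ {-1} : Set ℝ) :=
    (prob_compl_eq_zero_iff hmeas).2 hone
  rw [← Measure.restrict_eq_self_of_ae_mem hae,
    Measure.restrict_union hdisj (measurableSet_singleton _), Measure.restrict_singleton,
    Measure.restrict_singleton, h1, h2, signLaw]

theorem IsRandomSigns.map_eq_infinitePi {Ω : Type*} [MeasurableSpace Ω] {P : Measure Ω}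
    [IsProbabilityMeasure P] {ξ : ℕ → Ω → ℝ} (h : IsRandomSigns P ξ) :
    P.map (fun ω i => ξ i ω) = Measure.infinitePi fun _ : ℕ => signLaw := by
  rw [h.indep.map_fun_eq_infinitePi_map h.measurable]
  simp only [h.map_eq_signLaw]

/-! ### Stick breaking with random signs. -/

/-- Expresses the remaining length through the weights alone, without the fractions $u_i$. -/
theorem one_sub_sum_stickBreaking (u : ℕ → unitInterval) (n : ℕ) :
    1 - ∑ i ∈ Finset.range n, stickBreaking u i = ∏ i ∈ Finset.range n, (u i : ℝ) := by
  induction n with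
  | zero => simp
  | succ n ih =>
    rw [Finset.sum_range_succ, Finset.prod_range_succ, ← sub_sub, ih, stickBreaking]
    ring

/-- The law of independent uniform stick-breaking fractions and independent random signs. -/
noncomputable def stickLaw : Measure ((ℕ → unitInterval) × (ℕ → ℝ)) :=
  (Measure.infinitePi fun _ : ℕ => (volume : Measure unitInterval)).prod
    (Measure.infinitePi fun _ : ℕ => signLaw)

instance : IsProbabilityMeasure stickLaw := by
  unfold stickLaw
  infer_instance

/-- The signed sum of the first `n` pieces of the stick. -/
noncomputable def signedSum (n : ℕ) (q : (ℕ → unitInterval) × (ℕ → ℝ)) : ℝ :=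
  ∑ i ∈ Finset.range n, stickBreaking q.1 i * q.2 i

/-- The length of the stick that remains after `n` breaks. -/
noncomputable def remainder (n : ℕ) (q : (ℕ → unitInterval) × (ℕ → ℝ)) : ℝ :=
  ∏ i ∈ Finset.range n, (q.1 i : ℝ)

theorem measurable_signedSum (n : ℕ) : Measurable (signedSum n) := by
  have := measurable_stickBreaking
  unfold signedSum
  fun_prop

theorem measurable_remainder (n : ℕ) : Measurable (remainder n) := by
  unfold remainder
  fun_prop

theorem remainder_mem (n : ℕ) (q) : remainder n q ∈ Set.Icc 0 1 :=
  ⟨Finset.prod_nonneg fun i _ => (q.1 i).2.1,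
    Finset.prod_le_one (fun i _ => (q.1 i).2.1) fun i _ => (q.1 i).2.2⟩

theorem indepFun_prefix {E : Type*} [MeasurableSpace E] (μ : Measure E) [IsProbabilityMeasure μ]
    (n : ℕ) : IndepFun (fun (x : ℕ → E) (i : Finset.range n) => x i) (fun x => x n)
      (Measure.infinitePi fun _ : ℕ => μ) := by
  have h : iIndepFun (fun (i : ℕ) (x : ℕ → E) => x i) (Measure.infinitePi fun _ : ℕ => μ) :=
    iIndepFun_infinitePi (X := fun _ x => x) (fun _ => measurable_id)
  have := h.indepFun_finset (Finset.range n) {n} (by simp) (fun i => measurable_pi_apply i)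
  exact this.comp measurable_id (measurable_pi_apply ⟨n, Finset.mem_singleton_self n⟩)

/-- Extension of a finite sequence by a constant. -/
def extendBy {E : Type*} (c : E) {n : ℕ} (x : Finset.range n → E) (k : ℕ) : E :=
  if h : k ∈ Finset.range n then x ⟨k, h⟩ else c

theorem measurable_extendBy {E : Type*} [MeasurableSpace E] (c : E) (n : ℕ) :
    Measurable (extendBy c (n := n)) := by
  refine measurable_pi_lambda _ fun k => ?_
  by_cases h : k ∈ Finset.range n
  · simpa only [extendBy, h, dif_pos] using measurable_pi_apply _
  · simpa only [extendBy, h, dif_neg, not_false_eq_true] using measurable_const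

theorem extendBy_apply {E : Type*} (c : E) {n k : ℕ} (hk : k < n) (x : ℕ → E) :
    extendBy c (fun i : Finset.range n => x i) k = x k := by
  simp [extendBy, hk]

theorem indepFun_signedSum_remainder (n : ℕ) :
    IndepFun (fun q => (signedSum n q, remainder n q)) (fun q => (q.1 n, q.2 n)) stickLaw := by
  have h := indepFun_prodMap (by fun_prop) (by fun_prop) (by fun_prop) (by fun_prop)
    (indepFun_prefix (volume : Measure unitInterval) n) (indepFun_prefix signLaw n)
  have hext : Measurable fun p : (Finset.range n → unitInterval) × (Finset.range n → ℝ) =>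
      (extendBy 0 p.1, extendBy 0 p.2) :=
    ((measurable_extendBy 0 n).comp measurable_fst).prodMk
      ((measurable_extendBy 0 n).comp measurable_snd)
  -- Sum and remainder read only coordinates below $n$, so the padding value $0$ is never seen.
  have h' := h.comp (((measurable_signedSum n).prodMk (measurable_remainder n)).comp hext)
    measurable_id
  convert h' using 1
  · funext q
    simp only [Function.comp_apply, signedSum, remainder]
    congr 1
    · refine Finset.sum_congr rfl fun i hi => ?_
      have hi := Finset.mem_range.1 hi
      rw [extendBy_apply 0 hi q.2, stickBreaking, stickBreaking, extendBy_apply 0 hi q.1]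
      congr 2
      refine Finset.prod_congr rfl fun j hj => ?_
      rw [extendBy_apply 0 ((Finset.mem_range.1 hj).trans hi) q.1]
    · refine Finset.prod_congr rfl fun i hi => ?_
      rw [extendBy_apply 0 (Finset.mem_range.1 hi) q.1]
  · rfl
  · rfl

theorem map_coordinate (n : ℕ) :
    stickLaw.map (fun q => (q.1 n, q.2 n)) = (volume : Measure unitInterval).prod signLaw := by
  have := Measure.map_prod_map (Measure.infinitePi fun _ : ℕ => (volume : Measure unitInterval))
    (Measure.infinitePi fun _ : ℕ => signLaw) (measurable_pi_apply n) (measurable_pi_apply n)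
  rw [Measure.infinitePi_map_eval, Measure.infinitePi_map_eval] at this
  exact this.symm

/-- The Markov property of the stick-breaking process with random signs. -/
theorem integral_stickLaw_step (n : ℕ) {F : (ℝ × ℝ) × (unitInterval × ℝ) → ℝ} (hF : Measurable F)
    (hint : Integrable (fun q => F ((signedSum n q, remainder n q), (q.1 n, q.2 n))) stickLaw) :
    ∫ q, F ((signedSum n q, remainder n q), (q.1 n, q.2 n)) ∂stickLaw =
      ∫ q, (∫ u : unitInterval, (F ((signedSum n q, remainder n q), (u, 1)) +
        F ((signedSum n q, remainder n q), (u, -1))) / 2) ∂stickLaw := by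
  have hA : Measurable fun q => (signedSum n q, remainder n q) :=
    (measurable_signedSum n).prodMk (measurable_remainder n)
  have hB : Measurable fun q : (ℕ → unitInterval) × (ℕ → ℝ) => (q.1 n, q.2 n) := by fun_prop
  have hmap := (indepFun_iff_map_prod_eq_prod_map_map hA.aemeasurable hB.aemeasurable).1
    (indepFun_signedSum_remainder n)
  rw [map_coordinate] at hmap
  have hint' := (integrable_map_measure hF.aestronglyMeasurable (hA.prodMk hB).aemeasurable).2 hint
  rw [hmap] at hint'
  have hG : StronglyMeasurable fun a => ∫ u : unitInterval, (F (a, (u, 1)) + F (a, (u, -1))) / 2 :=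
    StronglyMeasurable.integral_prod_right' (f := fun p : (ℝ × ℝ) × unitInterval =>
      (F (p.1, (p.2, 1)) + F (p.1, (p.2, -1))) / 2) (Measurable.stronglyMeasurable (by fun_prop))
  rw [← integral_map (φ := fun q => ((signedSum n q, remainder n q), (q.1 n, q.2 n)))
    (hA.prodMk hB).aemeasurable hF.aestronglyMeasurable, hmap, integral_prod _ hint',
    ← integral_map (φ := fun q => (signedSum n q, remainder n q)) hA.aemeasurable
    hG.aestronglyMeasurable]
  refine integral_congr_ae ?_
  filter_upwards [hint'.prod_right_ae] with p hp
  rw [integral_prod _ hp]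
  simp only [integral_signLaw]

theorem integral_unitInterval (f : ℝ → ℝ) :
    ∫ u : unitInterval, f u = ∫ t in (0 : ℝ)..1, f t := by
  rw [intervalIntegral.integral_of_le zero_le_one, ← integral_Icc_eq_integral_Ioc]
  exact integral_subtype_comap measurableSet_Icc f

/-- With sign $+1$ the endpoint $s+r$ stays and the other becomes $s+r-2ru$; with $-1$ the endpoint
$s-r$ stays and the other becomes $s-r+2ru$. Both new endpoints are uniform on the segment, so
harmonicity applies. -/
theorem integral_arcsineMean_stick {g : ℝ → ℝ} (hg : Continuous g) (s r : ℝ) :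
    ∫ u : unitInterval, (arcsineMean g (s + r * (1 - (u : ℝ)) * 1 - r * u)
        (s + r * (1 - (u : ℝ)) * 1 + r * u) +
      arcsineMean g (s + r * (1 - (u : ℝ)) * (-1) - r * u)
        (s + r * (1 - (u : ℝ)) * (-1) + r * u)) / 2 = arcsineMean g (s - r) (s + r) := by
  have hcont : ∀ {f h : ℝ → ℝ}, Continuous f → Continuous h →
      Continuous fun t => arcsineMean g (f t) (h t) :=
    fun hf hh => (continuous_arcsineMean hg).comp (hf.prodMk hh)
  rw [integral_unitInterval fun u => (arcsineMean g (s + r * (1 - u) * 1 - r * u)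
        (s + r * (1 - u) * 1 + r * u) +
      arcsineMean g (s + r * (1 - u) * (-1) - r * u) (s + r * (1 - u) * (-1) + r * u)) / 2]
  have e : ∀ u : ℝ, (arcsineMean g (s + r * (1 - u) * 1 - r * u) (s + r * (1 - u) * 1 + r * u) +
      arcsineMean g (s + r * (1 - u) * (-1) - r * u) (s + r * (1 - u) * (-1) + r * u)) / 2 =
      (arcsineMean g (s + r - 2 * r * u) (s + r) +
        arcsineMean g (s - r) (s - r + 2 * r * u)) / 2 := fun u => by
    congr 3 <;> ring
  simp only [e]
  -- The change of variables divides by $2r$.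
  rcases eq_or_ne r 0 with rfl | hr
  · simp [arcsineMean_self]
  · have h2r : 2 * r ≠ 0 := mul_ne_zero two_ne_zero hr
    have key := integral_arcsineMean_add hg (s - r) (s + r)
    rw [intervalIntegral.integral_add
      ((hcont (by fun_prop) (by fun_prop)).intervalIntegrable _ _)
      ((hcont (by fun_prop) (by fun_prop)).intervalIntegrable _ _)] at key
    rw [intervalIntegral.integral_div, intervalIntegral.integral_add
      ((hcont (by fun_prop) (by fun_prop)).intervalIntegrable _ _)
      ((hcont (by fun_prop) (by fun_prop)).intervalIntegrable _ _),
      intervalIntegral.integral_comp_sub_mul (fun t => arcsineMean g t (s + r)) h2r,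
      intervalIntegral.integral_comp_add_mul (fun t => arcsineMean g (s - r) t) h2r]
    have e1 : s + r - 2 * r * 1 = s - r := by ring
    have e2 : s + r - 2 * r * 0 = s + r := by ring
    have e3 : s - r + 2 * r * 1 = s + r := by ring
    have e4 : s - r + 2 * r * 0 = s - r := by ring
    rw [e1, e2, e3, e4, ← smul_add, key, smul_eq_mul]
    field_simp
    ring

theorem signedSum_succ (n : ℕ) (q : (ℕ → unitInterval) × (ℕ → ℝ)) :
    signedSum (n + 1) q = signedSum n q + remainder n q * (1 - (q.1 n : ℝ)) * q.2 n :=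
  Finset.sum_range_succ _ _

theorem remainder_succ (n : ℕ) (q : (ℕ → unitInterval) × (ℕ → ℝ)) :
    remainder (n + 1) q = remainder n q * q.1 n :=
  Finset.prod_range_succ _ _

theorem integral_remainder (n : ℕ) : ∫ q, remainder n q ∂stickLaw = (1 / 2) ^ n := by
  induction n with
  | zero => simp [remainder]
  | succ n ih =>
    have hstep := integral_stickLaw_step n (F := fun p => p.1.2 * p.2.1) (by fun_prop) (by
      refine (Integrable.of_bound (measurable_remainder (n + 1)).aestronglyMeasurable 1
        (.of_forall fun q => ?_)).congr (.of_forall fun q => remainder_succ n q)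
      rw [Real.norm_eq_abs, abs_of_nonneg (remainder_mem _ q).1]
      exact (remainder_mem _ q).2)
    simp only [add_self_div_two, ← remainder_succ] at hstep
    rw [hstep, pow_succ, ← ih, ← integral_mul_const]
    refine integral_congr_ae (.of_forall fun q => ?_)
    simp only []
    rw [integral_const_mul, integral_unitInterval fun t => t, integral_id]
    norm_num

theorem integral_arcsineMean_stickLaw {g : ℝ → ℝ} (hg : Continuous g) {C : ℝ}
    (hC : ∀ y, |g y| ≤ C) (n : ℕ) :
    ∫ q, arcsineMean g (signedSum n q - remainder n q) (signedSum n q + remainder n q) ∂stickLaw =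
      arcsineMean g (-1) 1 := by
  have hcont := (continuous_arcsineMean hg).measurable
  induction n with
  | zero => simp [remainder, signedSum]
  | succ n ih =>
    have hF : Measurable fun p : (ℝ × ℝ) × (unitInterval × ℝ) =>
        arcsineMean g (p.1.1 + p.1.2 * (1 - (p.2.1 : ℝ)) * p.2.2 - p.1.2 * p.2.1)
          (p.1.1 + p.1.2 * (1 - (p.2.1 : ℝ)) * p.2.2 + p.1.2 * p.2.1) :=
      hcont.comp (f := fun p : (ℝ × ℝ) × (unitInterval × ℝ) =>
        ((p.1.1 + p.1.2 * (1 - (p.2.1 : ℝ)) * p.2.2 - p.1.2 * p.2.1 : ℝ),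
          (p.1.1 + p.1.2 * (1 - (p.2.1 : ℝ)) * p.2.2 + p.1.2 * p.2.1 : ℝ))) (by fun_prop)
    have hstep := integral_stickLaw_step n hF
      (Integrable.of_bound (hF.comp (((measurable_signedSum n).prodMk
        (measurable_remainder n)).prodMk (by fun_prop))).aestronglyMeasurable C
        (.of_forall fun q => abs_arcsineMean_le hC _ _))
    simp only [integral_arcsineMean_stick hg] at hstep
    simp only [signedSum_succ, remainder_succ]
    rw [hstep, ih]

/-! ### Transfer to GEM weights on an arbitrary probability space. -/

section Gem

variable {Ω : Type*} [MeasurableSpace Ω] {P : Measure Ω} {v : Ω → ℕ → ℝ} {ξ : ℕ → Ω → ℝ}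

/-- The weights are known only in law; this moves expectations in $(v,\xi)$ to `stickLaw`, where the
fractions are available. -/
theorem map_gem_signs [IsProbabilityMeasure P] (hv : HasLaw v gemOne P)
    (hξ : IsRandomSigns P ξ)
    (hind : IndepFun v (fun ω i => ξ i ω) P) :
    P.map (fun ω => (v ω, fun i => ξ i ω)) = stickLaw.map (Prod.map stickBreaking id) := by
  have hξm : Measurable fun ω i => ξ i ω := measurable_pi_lambda _ hξ.measurable
  rw [(indepFun_iff_map_prod_eq_prod_map_map hv.aemeasurable hξm.aemeasurable).1 hind, hv.map_eq,
    hξ.map_eq_infinitePi, gemOne, stickLaw,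
    ← Measure.map_prod_map _ _ measurable_stickBreaking measurable_id, Measure.map_id]

theorem integral_gem_signs [IsProbabilityMeasure P] (hv : HasLaw v gemOne P)
    (hξ : IsRandomSigns P ξ)
    (hind : IndepFun v (fun ω i => ξ i ω) P) {f : (ℕ → ℝ) × (ℕ → ℝ) → ℝ} (hf : Measurable f) :
    ∫ ω, f (v ω, fun i => ξ i ω) ∂P = ∫ q, f (stickBreaking q.1, q.2) ∂stickLaw := by
  have hξm : Measurable fun ω i => ξ i ω := measurable_pi_lambda _ hξ.measurable
  rw [← integral_map (φ := fun ω => (v ω, fun i => ξ i ω))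
    (hv.aemeasurable.prodMk hξm.aemeasurable) hf.aestronglyMeasurable, map_gem_signs hv hξ hind,
    integral_map (measurable_stickBreaking.prodMap measurable_id).aemeasurable
    hf.aestronglyMeasurable]
  rfl

theorem ae_gem_nonneg (hv : HasLaw v gemOne P) : ∀ᵐ ω ∂P, ∀ i, 0 ≤ v ω i := by
  refine ae_of_ae_map (p := fun w : ℕ → ℝ => ∀ i, 0 ≤ w i) hv.aemeasurable ?_
  rw [hv.map_eq, gemOne, ae_map_iff measurable_stickBreaking.aemeasurable
    (by measurability)]
  refine .of_forall fun u i => mul_nonneg (Finset.prod_nonneg fun j _ => (u j).2.1) ?_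
  linarith [(u i).2.2]

theorem ae_gem_sum_le_one (hv : HasLaw v gemOne P) :
    ∀ᵐ ω ∂P, ∀ n, ∑ i ∈ Finset.range n, v ω i ≤ 1 := by
  refine ae_all_iff.2 fun n => ae_of_ae_map (p := fun w : ℕ → ℝ => ∑ i ∈ Finset.range n, w i ≤ 1)
    hv.aemeasurable ?_
  rw [hv.map_eq, gemOne, ae_map_iff measurable_stickBreaking.aemeasurable
    (measurableSet_le (by fun_prop) measurable_const)]
  refine .of_forall fun u => ?_
  have : 0 ≤ ∏ i ∈ Finset.range n, (u i : ℝ) := Finset.prod_nonneg fun i _ => (u i).2.1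
  linarith [one_sub_sum_stickBreaking u n]

theorem IsRandomSigns.ae_abs_eq_one [IsProbabilityMeasure P] (hξ : IsRandomSigns P ξ) :
    ∀ᵐ ω ∂P, ∀ i, |ξ i ω| = 1 := by
  refine ae_all_iff.2 fun i => ?_
  refine ae_of_ae_map (p := fun e : ℝ => |e| = 1) (hξ.measurable i).aemeasurable ?_
  rw [hξ.map_eq_signLaw i, signLaw, ae_add_measure_iff]
  constructor <;>
  · refine Measure.ae_smul_measure ?_ _
    rw [ae_dirac_eq]
    simp

theorem ae_summable_gem_signs [IsProbabilityMeasure P] (hv : HasLaw v gemOne P)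
    (hξ : IsRandomSigns P ξ) :
    ∀ᵐ ω ∂P, Summable fun i => v ω i * ξ i ω := by
  filter_upwards [ae_gem_nonneg hv, ae_gem_sum_le_one hv, hξ.ae_abs_eq_one] with ω h0 h1 h2
  refine Summable.of_abs ((summable_of_sum_range_le h0 h1).congr fun i => ?_)
  rw [abs_mul, h2 i, mul_one, abs_of_nonneg (h0 i)]

/-- The remainder is nonnegative, decreasing in $n$ and has mean $2^{-n}$. -/
theorem ae_tendsto_gem_remainder [IsProbabilityMeasure P] (hvm : Measurable v)
    (hv : HasLaw v gemOne P) (hξ : IsRandomSigns P ξ) (hind : IndepFun v (fun ω i => ξ i ω) P) :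
    ∀ᵐ ω ∂P, Tendsto (fun n => 1 - ∑ i ∈ Finset.range n, v ω i) atTop (𝓝 0) := by
  have hmeas : ∀ n, Measurable fun ω => 1 - ∑ i ∈ Finset.range n, v ω i := fun n => by fun_prop
  refine tendsto_of_integral_tendsto_of_antitone (F := fun _ => (0 : ℝ)) (fun n => ?_)
    (integrable_const _) ?_ ?_ ?_
  · refine Integrable.of_bound (hmeas n).aestronglyMeasurable 1 ?_
    filter_upwards [ae_gem_nonneg hv, ae_gem_sum_le_one hv] with ω h0 h1
    rw [Real.norm_eq_abs, abs_of_nonneg (by linarith [h1 n])]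
    linarith [Finset.sum_nonneg fun i (_ : i ∈ Finset.range n) => h0 i]
  · have h : ∀ n, ∫ ω, (1 - ∑ i ∈ Finset.range n, v ω i) ∂P = (1 / 2) ^ n := fun n => by
      rw [integral_gem_signs hv hξ hind (f := fun p => 1 - ∑ i ∈ Finset.range n, p.1 i)
        (by fun_prop), ← integral_remainder n]
      simp only [one_sub_sum_stickBreaking, remainder]
    simp only [h, integral_zero]
    exact tendsto_pow_atTop_nhds_zero_of_lt_one (by norm_num) (by norm_num)
  · filter_upwards [ae_gem_nonneg hv] with ω h0
    refine antitone_nat_of_succ_le fun n => ?_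
    rw [Finset.sum_range_succ]
    linarith [h0 n]
  · filter_upwards [ae_gem_sum_le_one hv] with ω h1 n
    linarith [h1 n]

theorem cdf_tsum_gem_signs [IsProbabilityMeasure P] (hvm : Measurable v)
    (hv : HasLaw v gemOne P) (hξ : IsRandomSigns P ξ) (hind : IndepFun v (fun ω i => ξ i ω) P) {x : ℝ}
    (hx : x ∈ Set.Icc (-1 : ℝ) 1) :
    P.real {ω | ∑' i, v ω i * ξ i ω ≤ x} =
      2 / Real.pi * Real.arcsin (Real.sqrt ((x + 1) / 2)) := by
  have hξm := hξ.measurable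
  have hsum : ∀ᵐ ω ∂P, Tendsto (fun n => ∑ i ∈ Finset.range n, v ω i * ξ i ω) atTop
      (𝓝 (∑' i, v ω i * ξ i ω)) :=
    (ae_summable_gem_signs hv hξ).mono fun ω h => h.hasSum.tendsto_sum_nat
  have hrem := ae_tendsto_gem_remainder hvm hv hξ hind
  have hSm : ∀ n, Measurable fun ω => ∑ i ∈ Finset.range n, v ω i * ξ i ω := fun n => by fun_prop
  have hRm : ∀ n, Measurable fun ω => 1 - ∑ i ∈ Finset.range n, v ω i := fun n => by fun_prop
  rw [cdf_limit_of_integral_arcsineMean_eq (L := -1) (M := 1)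
    -- Endpoints of the segment still reachable: partial sum minus or plus the remaining length.
    (X := fun n ω => ∑ i ∈ Finset.range n, v ω i * ξ i ω - (1 - ∑ i ∈ Finset.range n, v ω i))
    (Y := fun n ω => ∑ i ∈ Finset.range n, v ω i * ξ i ω + (1 - ∑ i ∈ Finset.range n, v ω i))
    (fun n => (hSm n).sub (hRm n)) (fun n => (hSm n).add (hRm n))
    (aemeasurable_of_tendsto_metrizable_ae atTop (fun n => (hSm n).aemeasurable) hsum)
    (by filter_upwards [hsum, hrem] with ω h1 h2 using by simpa only [sub_zero] using h1.sub h2)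
    (by filter_upwards [hsum, hrem] with ω h1 h2 using by simpa only [add_zero] using h1.add h2)
    ?_ (by norm_num) hx]
  · norm_num
  · rintro g hg ⟨C, hC⟩ n
    rw [integral_gem_signs hv hξ hind
      (f := fun p => arcsineMean g
        (∑ i ∈ Finset.range n, p.1 i * p.2 i - (1 - ∑ i ∈ Finset.range n, p.1 i))
        (∑ i ∈ Finset.range n, p.1 i * p.2 i + (1 - ∑ i ∈ Finset.range n, p.1 i)))
      ((continuous_arcsineMean hg).measurable.comp (f := fun p : (ℕ → ℝ) × (ℕ → ℝ) =>
        ((∑ i ∈ Finset.range n, p.1 i * p.2 i - (1 - ∑ i ∈ Finset.range n, p.1 i) : ℝ),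
        (∑ i ∈ Finset.range n, p.1 i * p.2 i + (1 - ∑ i ∈ Finset.range n, p.1 i) : ℝ)))
        (by fun_prop)), ← integral_arcsineMean_stickLaw hg hC n]
    simp only [one_sub_sum_stickBreaking, remainder, signedSum]

end Gem

end DiminishingSegment

theorem theorem2 :
    -- the limit of the centres exists almost surely and has the translated arcsine law
    (∀ (Ω : Type*) [MeasurableSpace Ω] (P : Measure Ω) [IsProbabilityMeasure P]
        (a : ℕ → Ω → ℝ), DiminishingSegment.IsSegmentProcess P a →
      ∃ Z : Ω → ℝ, Measurable Z ∧
        (∀ᵐ ω ∂P, Tendsto (fun n => DiminishingSegment.centre (fun k => a k ω) n) atTop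
          (𝓝 (Z ω))) ∧
        ∀ x ∈ Set.Icc (-1 / 2 : ℝ) (1 / 2),
          P.real {ω | Z ω ≤ x} = 2 / Real.pi * Real.arcsin (Real.sqrt (x + 1 / 2))) ∧
    -- the reformulation for GEM(1) weights with independent random signs
    (∀ (Ω : Type*) [MeasurableSpace Ω] (P : Measure Ω) [IsProbabilityMeasure P]
        (v : Ω → ℕ → ℝ) (ξ : ℕ → Ω → ℝ), Measurable v → HasLaw v DiminishingSegment.gemOne P →
        DiminishingSegment.IsRandomSigns P ξ → IndepFun v (fun ω i => ξ i ω) P →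
      (∀ᵐ ω ∂P, Summable fun i => v ω i * ξ i ω) ∧
        ∀ x ∈ Set.Icc (-1 : ℝ) 1,
          P.real {ω | ∑' i, v ω i * ξ i ω ≤ x} =
            2 / Real.pi * Real.arcsin (Real.sqrt ((x + 1) / 2))) := by
  refine ⟨fun Ω _ P _ a h => h.exists_limit_arcsine, fun Ω _ P _ v ξ hvm hv hξ hind => ⟨?_, ?_⟩⟩
  · exact DiminishingSegment.ae_summable_gem_signs hv hξ
  · exact fun x hx => DiminishingSegment.cdf_tsum_gem_signs hvm hv hξ hind hx
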